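/- **Setting.** Let $G=(V,E,c)$ be a finite simple undirected graph with weights $c:E\to\mathbb N$. For $A\subseteq V$ let $c(A)$ be the total weight of the edges with exactly one end in $A$; if $\emptyset\ne A\ne V$ this is the capacity of the cut $(A,V\setminus A)$. For $x\neq y$ let $\lambda(G,x,y)$ be the smallest capacity of a cut with $x$ and $y$ on different sides. Write $c(x)$ for the weighted degree of a vertex $x$. **Algorithm (Parallel CAPFOREST).** Processes $1,\dots,p$ share an array $\mathcal T:V\to\{\text{true},\text{false}\}$, initially false everywhere, and a union-find structure $\mathcal U$ on $V$, initially with singleton blocks. Each process has its own set of visited vertices and blacklist $\mathcal B$ (both initially empty), values $r(v)=0$, $q(e)=0$, $\alpha=0$, a bound $\hat\lambda$ (initially a given number $\hat\lambda_0\in\mathbb N$, the same for all processes), and a priority queue $\mathcal Q$ that initially holds one arbitrary start vertex, with priority $0$. While its $\mathcal Q$ is nonempty, a process pops a vertex $x$ of maximum priority (ties broken arbitrarily) and marks it visited. If $\mathcal T(x)$ is true, it puts $x$ into $\mathcal B$ and goes on to the next pop. Otherwise it sets $\mathcal T(x)$ to true, sets $\alpha\leftarrow\alpha+c(x)-2r(x)$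 and, unless the vertices it has scanned so far (those visited and not blacklisted, $x$ included) are all of $V$, sets $\hat\lambda\leftarrow\min(\hat\lambda,\alpha)$. It then scans, in any order, the edges $e=(x,y)$ with $y$ not in $\mathcal B$ and not visited: if $r(y)<\hat\lambda\le r(y)+c(e)$, it marks $e$, that is, it merges the blocks of $x$ and $y$ in $\mathcal U$; then it sets $r(y)\leftarrow r(y)+c(e)$, $q(e)\leftarrow r(y)$, and gives $y$ the priority $\min(r(y),\hat\lambda)$ in $\mathcal Q$ (*capped* variant) or $r(y)$ (*uncapped* variant). The steps of the processes are interleaved arbitrarily, and reading $\mathcal T(x)$ and setting it are separate steps (no locks). A process may at any time lower its $\hat\lambda$ to the current bound of another process. **Theorem (Parallel CAPFOREST is correct).** In either variant, for every $p$, all start vertices, every $\hat\lambda_0$ and every interleaving, the following hold after any finite number of steps, whether or not the processes have finished (so early termination is allowed). 1. Whenever a process marks an edge $e=(x,y)$, $\lambda(G,x,y)\ge\hat\lambda$, where $\hat\lambda$ is the current bound of that process. 2. No cut whose capacity is below the current bounds of all processes is contracted: every block of $\mathcal U$ lies on one side of such a cut. 3. The bound of each process is either $\hat\lambda_0$, or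 is less than $\hat\lambda_0$ and is the capacity of a cut of $G$. 4. Whenever a process scans an edge $e=(x,y)$, $x$ and $y$ are not in its current blacklist $\mathcal B_e$. Let $\bar G$ be $G$ with the vertices in $\mathcal B_e$ and their incident edges removed, and let $q(e)$ be the value assigned in this scan. Then $$\min(q(e),\hat\lambda)\le\lambda(\bar G,x,y)\le\lambda(G,x,y),$$ where $\hat\lambda$ is the current bound of the process. In the uncapped variant moreover $q(e)\le\lambda(\bar G,x,y)$. 5. For every process and every edge $e=(x,y)$, with the current values of $q(e)$ and $\hat\lambda$ of that process: if $q(e)\ge\hat\lambda$ then $\lambda(G,x,y)\ge\hat\lambda$. In the uncapped variant moreover $q(e)\le\lambda(G,x,y)$. -/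

import Mathlib

namespace ParCut

/-! ### Weighted graphs, cuts and connectivity -/

/-- A weighted undirected graph `G = (V, E, c)` with weights in `ℕ`. Only the values of `weight` on
edges of `graph` are ever used. -/
structure WGraph (V : Type*) where
  graph : SimpleGraph V
  weight : Sym2 V → ℕ

open Classical in
/-- The weight of the edge `(u, v)`, and `0` if `u` and `v` are not adjacent. -/
noncomputable def WGraph.w {V : Type*} (G : WGraph V) (u v : V) : ℕ :=
  if G.graph.Adj u v then G.weight s(u, v) else 0

/-- The weighted degree `c(x)`. -/
noncomputable def WGraph.deg {V : Type*} [Fintype V] (G : WGraph V) (x : V) : ℕ :=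
  ∑ v, G.w x v

open Classical in
/-- The neighborhood `N(x)`. -/
noncomputable def WGraph.nbrs {V : Type*} [Fintype V] (G : WGraph V) (x : V) : Finset V :=
  Finset.univ.filter fun y => G.graph.Adj x y

/-- The capacity `c(A)` of the cut `(A, V \ A)`. -/
noncomputable def WGraph.cap {V : Type*} [Fintype V] [DecidableEq V] (G : WGraph V)
    (A : Finset V) : ℕ :=
  ∑ u ∈ A, ∑ v ∈ Aᶜ, G.w u v

/-- The connectivity `λ(G, a, b)` of two distinct vertices: the smallest capacity of a cut with
`a` and `b` on different sides. -/
noncomputable def WGraph.conn {V : Type*} [Fintype V] [DecidableEq V] (G : WGraph V)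
    (a b : V) : ℕ :=
  sInf {k | ∃ A : Finset V, a ∈ A ∧ b ∉ A ∧ G.cap A = k}

/-- The graph with the vertices in `B`, and all edges incident to them, removed. -/
def WGraph.remove {V : Type*} (G : WGraph V) (B : Finset V) : WGraph {v : V // v ∉ B} where
  graph := G.graph.comap Subtype.val
  weight := fun e => G.weight (e.map Subtype.val)

/-! ### The state of the algorithm -/

/-- Where a process stands. -/
inductive PC (V : Type*) where
  /-- at the head of the while loop -/
  | loop
  /-- `x` has been popped and marked visited; `T(x)` is to be read -/
  | check (x : V)
  /-- `T(x)` was read as false; `T(x)` is to be set -/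
  | claim (x : V)
  /-- `α` and the bound are to be updated for `x` -/
  | update (x : V)
  /-- inside the for loop over the edges at `x`; `todo` holds the neighbors not yet looked at -/
  | scan (x : V) (todo : Finset V)

/-- The variables owned by one process. -/
structure Local (V : Type*) where
  visited : Finset V
  blacklist : Finset V
  r : V → ℕ
  q : Sym2 V → ℕ
  /-- the priority of a vertex in the priority queue, `none` if it is not in the queue -/
  queue : V → Option ℕ
  alpha : ℕ
  /-- the upper bound that the process currently uses -/
  bound : ℕ
  pc : PC V

/-- The variables shared by all processes. -/
structure Shared (V : Type*) where
  /-- the vertices `x` with `T(x) = True` -/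
  T : Finset V
  /-- the partition kept by the union-find structure -/
  U : Setoid V

/-- `U.union(x, y)`: merge the blocks of `x` and `y`. -/
def unite {V : Type*} (U : Setoid V) (x y : V) : Setoid V :=
  U ⊔ Relation.EqvGen.setoid fun a b => a = x ∧ b = y

/-- What an atomic step does, as far as it matters to an observer. -/
inductive Event (V : Type*) where
  | silent
  /-- the edge `(x, y)` is scanned from `x`; `marked` tells if `U.union(x, y)` is performed -/
  | scan (x y : V) (marked : Bool)

/-- The priority given to a vertex: `r`, limited to the bound if `capped`. -/
def prio (capped : Bool) (r bound : ℕ) : ℕ :=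
  if capped then min r bound else r

/-- The local effect of scanning the edge `(x, y)` from `x`. -/
noncomputable def Local.scanEdge {V : Type*} [DecidableEq V] (G : WGraph V) (capped : Bool)
    (l : Local V) (x y : V) (todo : Finset V) : Local V :=
  { l with
    r := Function.update l.r y (l.r y + G.w x y)
    q := Function.update l.q s(x, y) (l.r y + G.w x y)
    queue := Function.update l.queue y (some (prio capped (l.r y + G.w x y) l.bound))
    pc := PC.scan x (todo.erase y) }

/-- The atomic steps of one process. Reading and writing `T` are separate steps (no locks). Ties in
the queue are broken arbitrarily, and the edges at a vertex are taken in arbitrary order. -/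
inductive ProcStep {V : Type*} [Fintype V] [DecidableEq V] (G : WGraph V) (capped : Bool) :
    Event V → Local V → Shared V → Local V → Shared V → Prop
  /-- `x ← Q.pop_max()`; mark `x` visited -/
  | pop (l : Local V) (sh : Shared V) (x : V) (k : ℕ)
      (hpc : l.pc = PC.loop) (hx : l.queue x = some k)
      (hmax : ∀ y m, l.queue y = some m → m ≤ k) :
      ProcStep G capped Event.silent l sh
        { l with
          queue := Function.update l.queue x none
          visited := insert x l.visited
          pc := PC.check x } sh
  /-- `T(x)` is true: blacklist `x` and leave it -/
  | blacklist (l : Local V) (sh : Shared V) (x : V)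
      (hpc : l.pc = PC.check x) (hT : x ∈ sh.T) :
      ProcStep G capped Event.silent l sh
        { l with
          blacklist := insert x l.blacklist
          pc := PC.loop } sh
  /-- `T(x)` is false: proceed with `x` -/
  | accept (l : Local V) (sh : Shared V) (x : V)
      (hpc : l.pc = PC.check x) (hT : x ∉ sh.T) :
      ProcStep G capped Event.silent l sh { l with pc := PC.claim x } sh
  /-- `T(x) ← True` -/
  | claim (l : Local V) (sh : Shared V) (x : V)
      (hpc : l.pc = PC.claim x) :
      ProcStep G capped Event.silent l sh
        { l with pc := PC.update x } { sh with T := insert x sh.T }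
  /-- `α ← α + c(x) - 2 r(x)`; if the vertices scanned so far (`x` included) are not all of `V`,
  so that they are one side of a cut, the bound becomes the minimum of itself and `α` -/
  | update (l : Local V) (sh : Shared V) (x : V)
      (hpc : l.pc = PC.update x) :
      ProcStep G capped Event.silent l sh
        { l with
          alpha := l.alpha + G.deg x - 2 * l.r x
          bound :=
            if l.visited \ l.blacklist = Finset.univ then l.bound
            else min l.bound (l.alpha + G.deg x - 2 * l.r x)
          pc := PC.scan x (G.nbrs x) } sh
  /-- scan `(x, y)` and mark it -/
  | scanMark (l : Local V) (sh : Shared V) (x y : V) (todo : Finset V)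
      (hpc : l.pc = PC.scan x todo) (hy : y ∈ todo)
      (hyb : y ∉ l.blacklist) (hyv : y ∉ l.visited)
      (hmark : l.r y < l.bound ∧ l.bound ≤ l.r y + G.w x y) :
      ProcStep G capped (Event.scan x y true) l sh
        (l.scanEdge G capped x y todo) { sh with U := unite sh.U x y }
  /-- scan `(x, y)` without marking it -/
  | scanPlain (l : Local V) (sh : Shared V) (x y : V) (todo : Finset V)
      (hpc : l.pc = PC.scan x todo) (hy : y ∈ todo)
      (hyb : y ∉ l.blacklist) (hyv : y ∉ l.visited)
      (hmark : ¬ (l.r y < l.bound ∧ l.bound ≤ l.r y + G.w x y)) :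
      ProcStep G capped (Event.scan x y false) l sh
        (l.scanEdge G capped x y todo) sh
  /-- pass over an edge to a blacklisted or visited vertex -/
  | skip (l : Local V) (sh : Shared V) (x y : V) (todo : Finset V)
      (hpc : l.pc = PC.scan x todo) (hy : y ∈ todo)
      (hyn : y ∈ l.blacklist ∨ y ∈ l.visited) :
      ProcStep G capped Event.silent l sh { l with pc := PC.scan x (todo.erase y) } sh
  /-- all edges at `x` are done -/
  | done (l : Local V) (sh : Shared V) (x : V)
      (hpc : l.pc = PC.scan x ∅) :
      ProcStep G capped Event.silent l sh { l with pc := PC.loop } sh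

/-- The joint state of `p` processes. -/
structure State (V : Type*) (p : ℕ) where
  proc : Fin p → Local V
  shared : Shared V

/-- A process at its start: only the start vertex is in the queue. -/
def Local.init {V : Type*} [DecidableEq V] (v : V) (bound₀ : ℕ) : Local V where
  visited := ∅
  blacklist := ∅
  r := fun _ => 0
  q := fun _ => 0
  queue := Function.update (fun _ => none) v (some 0)
  alpha := 0
  bound := bound₀
  pc := PC.loop

def State.init {V : Type*} [DecidableEq V] {p : ℕ} (start : Fin p → V) (bound₀ : ℕ) :
    State V p where
  proc := fun i => Local.init (start i) bound₀
  shared := { T := ∅, U := ⊥ }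

/-- `Step G capped i e s s'`: process `i` makes an atomic step with event `e`. It may also lower
its bound at any time to that of another process; so the bounds may be private, or kept equal, or
anything in between. -/
inductive Step {V : Type*} [Fintype V] [DecidableEq V] (G : WGraph V) (capped : Bool) {p : ℕ} :
    Fin p → Event V → State V p → State V p → Prop
  | run (s : State V p) (i : Fin p) (e : Event V) (l' : Local V) (sh' : Shared V)
      (h : ProcStep G capped e (s.proc i) s.shared l' sh') :
      Step G capped i e s { proc := Function.update s.proc i l', shared := sh' }
  | sync (s : State V p) (i j : Fin p) :
      Step G capped i Event.silent s
        { s with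
          proc := Function.update s.proc i
            { s.proc i with bound := min (s.proc i).bound (s.proc j).bound } }

/-- The states reached after finitely many steps, in any interleaving of the processes. No process
has to be finished, so this includes stopping any of them at any time. -/
inductive Reachable {V : Type*} [Fintype V] [DecidableEq V] (G : WGraph V) (capped : Bool) {p : ℕ}
    (start : Fin p → V) (bound₀ : ℕ) : State V p → Prop
  | init : Reachable G capped start bound₀ (State.init start bound₀)
  | step {s s' : State V p} {i : Fin p} {e : Event V} (h : Reachable G capped start bound₀ s)
      (hstep : Step G capped i e s s') : Reachable G capped start bound₀ s'

/-- Collapsing the blocks of `U` contracts the cut `(A, V \ A)`: some block meets both sides. -/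
def Contracts {V : Type*} (U : Setoid V) (A : Finset V) : Prop :=
  ∃ u v, U u v ∧ u ∈ A ∧ v ∉ A

end ParCut

namespace ParCut

section Cuts

variable {V : Type*}

theorem WGraph.w_comm (G : WGraph V) (u v : V) : G.w u v = G.w v u := by
  by_cases h : G.graph.Adj u v
  · simp [WGraph.w, h, h.symm, Sym2.eq_swap (a := u)]
  · simp [WGraph.w, h, mt G.graph.adj_symm h]

theorem WGraph.w_self (G : WGraph V) (u : V) : G.w u u = 0 := by
  simp [WGraph.w]

theorem WGraph.w_of_not_adj (G : WGraph V) {u v : V} (h : ¬ G.graph.Adj u v) : G.w u v = 0 := by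
  simp [WGraph.w, h]

theorem WGraph.remove_w (G : WGraph V) (B : Finset V) (u v : {v : V // v ∉ B}) :
    (G.remove B).w u v = G.w u v := by
  by_cases h : G.graph.Adj u v <;> simp [WGraph.w, WGraph.remove, h]

/-- The total weight of the edges between `y` and `S`. -/
noncomputable def WGraph.wt (G : WGraph V) (S : Finset V) (y : V) : ℕ :=
  ∑ u ∈ S, G.w u y

variable [DecidableEq V]

/-- The weight of the edges inside `T` that cross the cut given by `A`. -/
noncomputable def WGraph.capOn (G : WGraph V) (T A : Finset V) : ℕ :=
  ∑ u ∈ T ∩ A, ∑ v ∈ T \ A, G.w u v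

theorem WGraph.wt_insert (G : WGraph V) {S : Finset V} {x : V} (hx : x ∉ S) (y : V) :
    G.wt (insert x S) y = G.w x y + G.wt S y :=
  Finset.sum_insert hx

theorem WGraph.capOn_insert_of_mem (G : WGraph V) {T A : Finset V} {x : V} (hx : x ∉ T)
    (hA : x ∈ A) : G.capOn (insert x T) A = G.capOn T A + ∑ v ∈ T \ A, G.w x v := by
  rw [WGraph.capOn, Finset.insert_inter_of_mem hA, Finset.insert_sdiff_of_mem _ hA,
    Finset.sum_insert (by simp [hx]), add_comm]
  rfl

theorem WGraph.capOn_insert_of_notMem (G : WGraph V) {T A : Finset V} {y : V} (hy : y ∉ T)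
    (hA : y ∉ A) : G.capOn (insert y T) A = G.capOn T A + ∑ u ∈ T ∩ A, G.w u y := by
  rw [WGraph.capOn, Finset.insert_inter_of_notMem hA, Finset.insert_sdiff_of_notMem _ hA,
    add_comm, WGraph.capOn, ← Finset.sum_add_distrib]
  exact Finset.sum_congr rfl fun u _ => Finset.sum_insert (by simp [hy])

theorem WGraph.capOn_add_le_of_mem (G : WGraph V) {T A : Finset V} {x y : V} (hx : x ∉ T)
    (hA : x ∈ A) (hyT : y ∈ T) (hyA : y ∉ A) :
    G.capOn T A + G.w x y ≤ G.capOn (insert x T) A := by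
  rw [G.capOn_insert_of_mem hx hA]
  exact Nat.add_le_add_left (Finset.single_le_sum (f := fun v => G.w x v)
    (fun _ _ => Nat.zero_le _) (by simp [hyT, hyA])) _

theorem WGraph.capOn_add_le_of_notMem (G : WGraph V) {T A : Finset V} {x y : V} (hy : y ∉ T)
    (hA : y ∉ A) (hxT : x ∈ T) (hxA : x ∈ A) :
    G.capOn T A + G.w x y ≤ G.capOn (insert y T) A := by
  rw [G.capOn_insert_of_notMem hy hA]
  exact Nat.add_le_add_left (Finset.single_le_sum (f := fun u => G.w u y)
    (fun _ _ => Nat.zero_le _) (by simp [hxT, hxA])) _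

/-- Outside of `B`, any cut between `x` and a vertex `y` not in `S` has at least the weight of the
edges between `y` and `S`, limited to `L`, already inside `S ∪ {y}`. -/
def Tight (G : WGraph V) (L : ℕ) (B S : Finset V) (x : V) : Prop :=
  ∀ y, y ∉ S → y ∉ B → ∀ A : Finset V, x ∈ A → y ∉ A →
    min (G.wt S y) L ≤ G.capOn (insert y S) A

theorem Tight.mono {G : WGraph V} {L : ℕ} {B B' S : Finset V} {x : V} (h : Tight G L B S x)
    (hB : B ⊆ B') : Tight G L B' S x :=
  fun y hyS hyB => h y hyS fun hy => hyB (hB hy)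

theorem tight_singleton (G : WGraph V) (L : ℕ) (B : Finset V) (x : V) : Tight G L B {x} x := by
  intro y hyS _ A hx hy
  refine (min_le_left _ _).trans ?_
  rw [WGraph.wt, Finset.sum_singleton]
  exact (Nat.le_add_left _ _).trans (G.capOn_add_le_of_notMem hyS hy (by simp) hx)

variable [Fintype V]

theorem WGraph.capOn_compl (G : WGraph V) (T A : Finset V) : G.capOn T Aᶜ = G.capOn T A := by
  have h₁ : T ∩ Aᶜ = T \ A := by ext; simp
  have h₂ : T \ Aᶜ = T ∩ A := by ext; simp
  rw [WGraph.capOn, WGraph.capOn, h₁, h₂, Finset.sum_comm]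
  exact Finset.sum_congr rfl fun u _ => Finset.sum_congr rfl fun v _ => G.w_comm _ _

theorem WGraph.cap_eq_capOn_univ (G : WGraph V) (A : Finset V) :
    G.cap A = G.capOn Finset.univ A := by
  simp [WGraph.cap, WGraph.capOn, Finset.compl_eq_univ_sdiff]

theorem WGraph.cap_compl (G : WGraph V) (A : Finset V) : G.cap Aᶜ = G.cap A := by
  simp only [WGraph.cap_eq_capOn_univ, WGraph.capOn_compl]

theorem WGraph.cap_add_deg (G : WGraph V) {S : Finset V} {x : V} (hx : x ∉ S) :
    G.cap S + G.deg x = G.cap (insert x S) + 2 * G.wt S x := by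
  have hc : Sᶜ = insert x (insert x S)ᶜ := by
    ext v; by_cases h : v = x <;> simp [h, hx]
  have hn : x ∉ (insert x S)ᶜ := by simp
  have h₁ : G.cap S = G.wt S x + ∑ u ∈ S, ∑ v ∈ (insert x S)ᶜ, G.w u v := by
    rw [WGraph.cap, hc, WGraph.wt, ← Finset.sum_add_distrib]
    exact Finset.sum_congr rfl fun u _ => Finset.sum_insert hn
  have h₂ : G.cap (insert x S) = (∑ v ∈ (insert x S)ᶜ, G.w x v) +
      ∑ u ∈ S, ∑ v ∈ (insert x S)ᶜ, G.w u v := Finset.sum_insert hx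
  have h₃ : G.deg x = G.wt S x + ∑ v ∈ (insert x S)ᶜ, G.w x v := by
    rw [WGraph.deg, ← Finset.sum_add_sum_compl (insert x S), Finset.sum_insert hx, G.w_self,
      zero_add, WGraph.wt]
    simp only [G.w_comm x]
  omega

theorem WGraph.conn_le_cap (G : WGraph V) {a b : V} {A : Finset V} (ha : a ∈ A) (hb : b ∉ A) :
    G.conn a b ≤ G.cap A :=
  Nat.sInf_le ⟨A, ha, hb, rfl⟩

theorem WGraph.le_conn (G : WGraph V) {a b : V} (hab : a ≠ b) {k : ℕ}
    (h : ∀ A : Finset V, a ∈ A → b ∉ A → k ≤ G.cap A) : k ≤ G.conn a b := by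
  refine le_csInf ⟨_, {a}, by simp, by simpa using hab.symm, rfl⟩ ?_
  rintro _ ⟨A, ha, hb, rfl⟩
  exact h A ha hb

theorem WGraph.conn_comm (G : WGraph V) {a b : V} (hab : a ≠ b) : G.conn a b = G.conn b a := by
  have key : ∀ {a b : V}, a ≠ b → G.conn a b ≤ G.conn b a := fun {a b} hab =>
    G.le_conn hab.symm fun A hb ha => by
      rw [← G.cap_compl]
      exact G.conn_le_cap (by simpa using ha) (by simpa using hb)
  exact le_antisymm (key hab) (key hab.symm)

theorem WGraph.capOn_le_cap_remove (G : WGraph V) {B T : Finset V} (hT : Disjoint T B)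
    (A : Finset {v : V // v ∉ B}) :
    G.capOn T (A.map (Function.Embedding.subtype _)) ≤ (G.remove B).cap A := by
  have h : (G.remove B).cap A = ∑ u ∈ A.map (Function.Embedding.subtype _),
      ∑ v ∈ Aᶜ.map (Function.Embedding.subtype _), G.w u v := by
    simp [WGraph.cap, G.remove_w]
  rw [h, WGraph.capOn]
  refine (Finset.sum_le_sum_of_subset Finset.inter_subset_right).trans
    (Finset.sum_le_sum fun u _ => Finset.sum_le_sum_of_subset fun v hv => ?_)
  have hvB : v ∉ B := Finset.disjoint_left.1 hT (Finset.mem_sdiff.1 hv).1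
  simpa [hvB] using (Finset.mem_sdiff.1 hv).2

theorem WGraph.conn_remove_le (G : WGraph V) {B : Finset V} {a b : V} (ha : a ∉ B) (hb : b ∉ B)
    (hab : a ≠ b) : (G.remove B).conn ⟨a, ha⟩ ⟨b, hb⟩ ≤ G.conn a b := by
  refine G.le_conn hab fun A hA hA' => ?_
  refine ((G.remove B).conn_le_cap (A := A.subtype (· ∉ B)) (by simpa using hA)
    (by simpa using hA')).trans ?_
  have h : (G.remove B).cap (A.subtype (· ∉ B)) =
      ∑ u ∈ (A.subtype (· ∉ B)).map (Function.Embedding.subtype _),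
        ∑ v ∈ (A.subtype (· ∉ B))ᶜ.map (Function.Embedding.subtype _), G.w u v := by
    simp only [WGraph.cap, G.remove_w, Finset.sum_map, Function.Embedding.subtype_apply]
  rw [h, WGraph.cap]
  refine (Finset.sum_le_sum_of_subset fun u hu => ?_).trans
    (Finset.sum_le_sum fun u _ => Finset.sum_le_sum_of_subset fun v hv => ?_)
  · simp at hu; exact hu.1
  · simp at hv ⊢; exact hv.1

/-- A vertex of maximum adjacency (up to `L`) can be appended. -/
theorem Tight.insert {G : WGraph V} {L : ℕ} {B S : Finset V} {x x' : V} (h : Tight G L B S x')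
    (hxS : x ∉ S) (hxB : x ∉ B)
    (hmax : ∀ y, y ∉ S → y ∉ B → min (G.wt S y) L ≤ G.wt S x) :
    Tight G L B (insert x S) x := by
  intro y hyS hyB A hx hy
  simp only [Finset.mem_insert, not_or] at hyS
  rw [G.wt_insert hxS]
  by_cases hx' : x' ∈ A
  · have h₁ := h y hyS.2 hyB A hx' hy
    have h₂ := G.capOn_add_le_of_mem (T := Insert.insert y S) (x := x) (y := y)
      (by simp [hxS, Ne.symm hyS.1]) hx (by simp) hy
    rw [Finset.insert_comm]
    omega
  · have h₁ := h x hxS hxB Aᶜ (by simpa using hx') (by simpa using hx)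
    rw [G.capOn_compl] at h₁
    have h₂ := G.capOn_add_le_of_notMem (T := Insert.insert x S) (x := x) (y := y)
      (by simp [hyS.1, hyS.2]) hy (by simp) hx
    have h₃ := hmax y hyS.2 hyB
    omega

theorem Tight.le_conn_remove {G : WGraph V} {L : ℕ} {B S : Finset V} {x y : V}
    (h : Tight G L B S x) (hSB : Disjoint S B) (hx : x ∉ B) (hyS : y ∉ S) (hy : y ∉ B)
    (hxy : x ≠ y) : min (G.wt S y) L ≤ (G.remove B).conn ⟨x, hx⟩ ⟨y, hy⟩ := by
  refine (G.remove B).le_conn (by simpa using hxy) fun A hA hA' => ?_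
  refine (h y hyS hy (A.map (Function.Embedding.subtype _)) ?_ ?_).trans
    (G.capOn_le_cap_remove (by simp [hy, hSB]) A)
  · simpa [hx] using hA
  · simpa [hy] using hA'

end Cuts

theorem unite_le {V : Type*} {U W : Setoid V} {x y : V} (hU : U ≤ W) (hxy : W x y) : unite U x y ≤ W := by
  refine sup_le hU (Setoid.eqvGen_le ?_)
  rintro a b ⟨rfl, rfl⟩
  exact hxy

section Invariant

variable {V : Type*} [Fintype V] [DecidableEq V]

/-- The levels up to which the priorities of the queue are reliable. -/
def Reliable (capped : Bool) (bound L : ℕ) : Prop :=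
  capped = false ∨ L ≤ bound

theorem Reliable.mono {capped : Bool} {b b' L : ℕ} (h : Reliable capped b L) (hb : b ≤ b') :
    Reliable capped b' L :=
  h.imp_right fun h => h.trans hb

/-- The part of the invariant of a process that depends on where it stands; `S` is the set of
vertices for which the bound has been updated. -/
def PCInv (G : WGraph V) (capped : Bool) (l : Local V) (S : Finset V) : PC V → Prop
  | .loop => l.visited = S ∪ l.blacklist ∧ (∀ y, y ∉ l.visited → l.r y = G.wt S y) ∧
      (S = ∅ ∨ ∃ x, ∀ L, Reliable capped l.bound L → Tight G L l.blacklist S x)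
  | .check x | .claim x | .update x =>
      x ∉ S ∧ x ∉ l.blacklist ∧ l.visited = insert x (S ∪ l.blacklist) ∧ l.r x = G.wt S x ∧
      (∀ y, y ∉ l.visited → l.r y = G.wt S y) ∧
      (S = ∅ ∨ ∃ x, ∀ L, Reliable capped l.bound L → Tight G L l.blacklist S x) ∧
      ∀ L, Reliable capped l.bound L → Tight G L l.blacklist (insert x S) x
  | .scan x todo => x ∈ S ∧ todo ⊆ G.nbrs x ∧ l.visited = S ∪ l.blacklist ∧
      (∀ y, y ∉ l.visited → l.r y + (if y ∈ todo then G.w x y else 0) = G.wt S y) ∧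
      ∀ L, Reliable capped l.bound L → Tight G L l.blacklist S x

/-- The invariant of a process. -/
structure LocalInv (G : WGraph V) (capped : Bool) (bound₀ : ℕ) (l : Local V) (S : Finset V) :
    Prop where
  disjoint : Disjoint S l.blacklist
  queue_visited : ∀ x ∈ l.visited, l.queue x = none
  prio_le : ∀ x k, l.queue x = some k → k ≤ l.r x
  le_prio : ∀ L, Reliable capped l.bound L → ∀ y, y ∉ l.visited →
    min (l.r y) L ≤ (l.queue y).getD 0
  alpha : l.alpha = G.cap S
  bound : l.bound = bound₀ ∨ l.bound < bound₀ ∧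
    ∃ A : Finset V, A ≠ ∅ ∧ A ≠ Finset.univ ∧ l.bound = G.cap A
  q_le : ∀ L, Reliable capped l.bound L → ∀ x y, G.graph.Adj x y →
    min (l.q s(x, y)) L ≤ G.conn x y
  pc : PCInv G capped l S l.pc

theorem PCInv.lower {G : WGraph V} {capped : Bool} {l : Local V} {S : Finset V} {b : ℕ}
    (hb : b ≤ l.bound) : ∀ {c : PC V}, PCInv G capped l S c →
      PCInv G capped { l with bound := b } S c
  | .loop, ⟨h₁, h₂, h₃⟩ =>
    ⟨h₁, h₂, h₃.imp_right fun ⟨x, h⟩ => ⟨x, fun L hL => h L (hL.mono hb)⟩⟩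
  | .check _, ⟨h₁, h₂, h₃, h₄, h₅, h₆, h₇⟩ | .claim _, ⟨h₁, h₂, h₃, h₄, h₅, h₆, h₇⟩
  | .update _, ⟨h₁, h₂, h₃, h₄, h₅, h₆, h₇⟩ =>
    ⟨h₁, h₂, h₃, h₄, h₅, h₆.imp_right fun ⟨x, h⟩ => ⟨x, fun L hL => h L (hL.mono hb)⟩,
      fun L hL => h₇ L (hL.mono hb)⟩
  | .scan _ _, ⟨h₁, h₂, h₃, h₄, h₅⟩ => ⟨h₁, h₂, h₃, h₄, fun L hL => h₅ L (hL.mono hb)⟩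

theorem LocalInv.lower {G : WGraph V} {capped : Bool} {bound₀ : ℕ} {l : Local V} {S : Finset V}
    (h : LocalInv G capped bound₀ l S) {b : ℕ} (hb : b ≤ l.bound)
    (hb' : b = bound₀ ∨ b < bound₀ ∧
      ∃ A : Finset V, A ≠ ∅ ∧ A ≠ Finset.univ ∧ b = G.cap A) :
    LocalInv G capped bound₀ { l with bound := b } S where
  disjoint := h.disjoint
  queue_visited := h.queue_visited
  prio_le := h.prio_le
  le_prio := fun L hL => h.le_prio L (hL.mono hb)
  alpha := h.alpha
  bound := hb'
  q_le := fun L hL => h.q_le L (hL.mono hb)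
  pc := h.pc.lower hb

theorem LocalInv.init (G : WGraph V) (capped : Bool) (v : V) (bound₀ : ℕ) :
    LocalInv G capped bound₀ (Local.init v bound₀) ∅ where
  disjoint := by simp
  queue_visited := by simp [Local.init]
  prio_le := by
    intro x k
    by_cases h : x = v
    · subst h; simp [Local.init, eq_comm]
    · simp [Local.init, Function.update_of_ne h]
  le_prio := by simp [Local.init]
  alpha := by simp [Local.init, WGraph.cap]
  bound := Or.inl rfl
  q_le := by simp [Local.init]
  pc := by simp [Local.init, PCInv, WGraph.wt]

/-- What holds of a process that is about to scan the edge `(x, y)`. -/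
theorem LocalInv.scan {G : WGraph V} {capped : Bool} {bound₀ : ℕ} {l : Local V} {S : Finset V}
    (h : LocalInv G capped bound₀ l S) {x y : V} {todo : Finset V} (hpc : l.pc = PC.scan x todo)
    (hy : y ∈ todo) (hyb : y ∉ l.blacklist) (hyv : y ∉ l.visited) :
    G.graph.Adj x y ∧ ∃ hx : x ∉ l.blacklist, ∀ L, Reliable capped l.bound L →
      min (l.r y + G.w x y) L ≤ (G.remove l.blacklist).conn ⟨x, hx⟩ ⟨y, hyb⟩ := by
  have hp := h.pc
  rw [hpc] at hp
  obtain ⟨hxS, htodo, hvis, hr, ht⟩ := hp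
  have hadj : G.graph.Adj x y := by simpa [WGraph.nbrs] using htodo hy
  have hxB : x ∉ l.blacklist := Finset.disjoint_left.1 h.disjoint hxS
  refine ⟨hadj, hxB, fun L hL => ?_⟩
  have hry := hr y hyv
  rw [if_pos hy] at hry
  rw [hry]
  refine (ht L hL).le_conn_remove h.disjoint hxB (fun hyS => hyv ?_) hyb hadj.ne
  rw [hvis]
  exact Finset.mem_union_left _ hyS

theorem le_prio_of_reliable {capped : Bool} {b L : ℕ} (h : Reliable capped b L) (r : ℕ) :
    min r L ≤ prio capped r b := by
  cases capped with
  | false => simp [prio]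
  | true =>
    have : L ≤ b := by simpa [Reliable] using h
    simp only [prio, if_true]
    omega

theorem prio_le_self (capped : Bool) (r b : ℕ) : prio capped r b ≤ r := by
  cases capped <;> simp [prio]

theorem LocalInv.scanEdge {G : WGraph V} {capped : Bool} {bound₀ : ℕ} {l : Local V}
    {S : Finset V} (h : LocalInv G capped bound₀ l S) {x y : V} {todo : Finset V}
    (hpc : l.pc = PC.scan x todo) (hy : y ∈ todo) (hyb : y ∉ l.blacklist)
    (hyv : y ∉ l.visited) : LocalInv G capped bound₀ (l.scanEdge G capped x y todo) S where
  disjoint := h.disjoint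
  queue_visited := fun z hz => by
    have hzy : z ≠ y := by rintro rfl; exact hyv hz
    simpa [Local.scanEdge, Function.update_of_ne hzy] using h.queue_visited z hz
  prio_le := fun z k => by
    by_cases hzy : z = y
    · subst hzy
      simp only [Local.scanEdge, Function.update_self, Option.some.injEq]
      rintro rfl
      exact prio_le_self _ _ _
    · simpa [Local.scanEdge, Function.update_of_ne hzy] using h.prio_le z k
  le_prio := fun L hL z hz => by
    by_cases hzy : z = y
    · subst hzy
      simp only [Local.scanEdge, Function.update_self, Option.getD_some]
      exact le_prio_of_reliable hL _
    · simpa only [Local.scanEdge, Function.update_of_ne hzy] using h.le_prio L hL z hz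
  alpha := h.alpha
  bound := h.bound
  q_le := fun L hL a b hab => by
    obtain ⟨hadj, hx, hle⟩ := h.scan hpc hy hyb hyv
    have hxy : min (l.r y + G.w x y) L ≤ G.conn x y :=
      (hle L hL).trans (G.conn_remove_le hx hyb hadj.ne)
    by_cases hs : s(a, b) = s(x, y)
    · simp only [Local.scanEdge, hs, Function.update_self]
      rcases Sym2.eq_iff.1 hs with ⟨rfl, rfl⟩ | ⟨rfl, rfl⟩
      · exact hxy
      · rwa [G.conn_comm hab.ne]
    · simpa only [Local.scanEdge, Function.update_of_ne hs] using h.q_le L hL a b hab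
  pc := by
    have hp := h.pc
    rw [hpc] at hp
    obtain ⟨hxS, htodo, hvis, hr, ht⟩ := hp
    refine ⟨hxS, (Finset.erase_subset _ _).trans htodo, hvis, fun z hz => ?_, ht⟩
    have hrz := hr z hz
    by_cases hzy : z = y
    · subst hzy
      simpa [Local.scanEdge, hy] using hrz
    · simpa [Local.scanEdge, Function.update_of_ne hzy, hzy] using hrz

theorem LocalInv.pop {G : WGraph V} {capped : Bool} {bound₀ : ℕ} {l : Local V} {S : Finset V}
    (h : LocalInv G capped bound₀ l S) {x : V} {k : ℕ} (hpc : l.pc = PC.loop)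
    (hx : l.queue x = some k) (hmax : ∀ y m, l.queue y = some m → m ≤ k) :
    LocalInv G capped bound₀
      { l with
        queue := Function.update l.queue x none
        visited := insert x l.visited
        pc := PC.check x } S where
  disjoint := h.disjoint
  queue_visited := fun z hz => by
    by_cases hzx : z = x
    · subst hzx; simp
    · simpa [Function.update_of_ne hzx] using
        h.queue_visited z (Finset.mem_of_mem_insert_of_ne hz hzx)
  prio_le := fun z m => by
    by_cases hzx : z = x
    · subst hzx; simp
    · simpa [Function.update_of_ne hzx] using h.prio_le z m
  le_prio := fun L hL z hz => by
    simp only [Finset.mem_insert, not_or] at hz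
    simpa only [Function.update_of_ne hz.1] using h.le_prio L hL z hz.2
  alpha := h.alpha
  bound := h.bound
  q_le := h.q_le
  pc := by
    have hp := h.pc
    rw [hpc] at hp
    obtain ⟨hvis, hr, ht⟩ := hp
    have hxv : x ∉ l.visited := fun hv => by simp [h.queue_visited x hv] at hx
    have hxSB := hxv
    rw [hvis, Finset.mem_union, not_or] at hxSB
    refine ⟨hxSB.1, hxSB.2, congrArg (insert x) hvis, hr x hxv,
      fun y hy => hr y fun hv => hy (Finset.mem_insert_of_mem hv), ht, fun L hL => ?_⟩
    rcases ht with rfl | ⟨x', ht⟩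
    · exact tight_singleton G L _ x
    · refine (ht L hL).insert hxSB.1 hxSB.2 fun y hyS hyB => ?_
      have hyv : y ∉ l.visited := by simp [hvis, hyS, hyB]
      have h₁ := h.le_prio L hL y hyv
      have h₂ : (l.queue y).getD 0 ≤ k := by
        cases hq : l.queue y with
        | none => simp
        | some m => simpa using hmax y m hq
      rw [← hr y hyv, ← hr x hxv]
      exact h₁.trans (h₂.trans (h.prio_le x k hx))

theorem LocalInv.blacklist {G : WGraph V} {capped : Bool} {bound₀ : ℕ} {l : Local V}
    {S : Finset V} (h : LocalInv G capped bound₀ l S) {x : V} (hpc : l.pc = PC.check x) :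
    LocalInv G capped bound₀
      { l with blacklist := insert x l.blacklist, pc := PC.loop } S := by
  have hp := h.pc
  rw [hpc] at hp
  obtain ⟨hxS, hxB, hvis, hrx, hr, ht, -⟩ := hp
  refine ⟨?_, h.queue_visited, h.prio_le, h.le_prio, h.alpha, h.bound, h.q_le, ?_, hr,
    ht.imp_right fun ⟨x', ht⟩ => ⟨x', fun L hL => (ht L hL).mono (Finset.subset_insert _ _)⟩⟩
  · simp [hxS, h.disjoint]
  · simp [hvis]

theorem LocalInv.update {G : WGraph V} {capped : Bool} {bound₀ : ℕ} {l : Local V}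
    {S : Finset V} (h : LocalInv G capped bound₀ l S) {x : V} (hpc : l.pc = PC.update x) :
    LocalInv G capped bound₀
      { l with
        alpha := l.alpha + G.deg x - 2 * l.r x
        bound :=
          if l.visited \ l.blacklist = Finset.univ then l.bound
          else min l.bound (l.alpha + G.deg x - 2 * l.r x)
        pc := PC.scan x (G.nbrs x) } (insert x S) := by
  have hp := h.pc
  rw [hpc] at hp
  obtain ⟨hxS, hxB, hvis, hrx, hr, -, ht⟩ := hp
  have hα : l.alpha + G.deg x - 2 * l.r x = G.cap (insert x S) := by
    rw [h.alpha, hrx, G.cap_add_deg hxS]; omega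
  have hd : Disjoint (insert x S) l.blacklist := by simp [hxB, h.disjoint]
  have hS : l.visited \ l.blacklist = insert x S := by
    rw [hvis, ← Finset.insert_union, Finset.union_sdiff_right, Finset.sdiff_eq_self_of_disjoint hd]
  rw [hα, hS]
  have hle : (if insert x S = Finset.univ then l.bound else min l.bound (G.cap (insert x S))) ≤
      l.bound := by
    split_ifs <;> simp
  have hb : LocalInv G capped bound₀ { l with
      bound := if insert x S = Finset.univ then l.bound
        else min l.bound (G.cap (insert x S)) } S := by
    refine h.lower hle ?_
    split_ifs with hu
    · exact h.bound
    · rcases le_or_gt l.bound (G.cap (insert x S)) with hc | hc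
      · rw [min_eq_left hc]; exact h.bound
      · rw [min_eq_right hc.le]
        have : l.bound ≤ bound₀ := by
          rcases h.bound with hb | hb
          · exact hb.le
          · exact hb.1.le
        exact Or.inr ⟨hc.trans_le this, _, Finset.insert_ne_empty _ _, hu, rfl⟩
  refine ⟨hd, h.queue_visited, h.prio_le, hb.le_prio, rfl, hb.bound, hb.q_le,
    Finset.mem_insert_self _ _, subset_rfl, ?_, fun y hy => ?_, fun L hL => ht L (hL.mono hle)⟩
  · simp [hvis]
  · rw [G.wt_insert hxS, ← hr y hy, add_comm]
    congr 1
    split_ifs with hn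
    · rfl
    · exact (G.w_of_not_adj (by simpa [WGraph.nbrs] using hn)).symm

theorem LocalInv.skip {G : WGraph V} {capped : Bool} {bound₀ : ℕ} {l : Local V} {S : Finset V}
    (h : LocalInv G capped bound₀ l S) {x y : V} {todo : Finset V} (hpc : l.pc = PC.scan x todo)
    (hyn : y ∈ l.blacklist ∨ y ∈ l.visited) :
    LocalInv G capped bound₀ { l with pc := PC.scan x (todo.erase y) } S := by
  have hp := h.pc
  rw [hpc] at hp
  obtain ⟨hxS, htodo, hvis, hr, ht⟩ := hp
  refine ⟨h.disjoint, h.queue_visited, h.prio_le, h.le_prio, h.alpha, h.bound, h.q_le,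
    hxS, (Finset.erase_subset _ _).trans htodo, hvis, fun z hz => ?_, ht⟩
  have hzy : z ≠ y := by
    rintro rfl
    refine hz (hyn.elim (fun hb => ?_) id)
    simp [hvis, hb]
  simpa [hzy] using hr z hz

theorem LocalInv.step {G : WGraph V} {capped : Bool} {bound₀ : ℕ} {l l' : Local V}
    {sh sh' : Shared V} {e : Event V} {S : Finset V} (h : LocalInv G capped bound₀ l S)
    (hs : ProcStep G capped e l sh l' sh') : ∃ S', LocalInv G capped bound₀ l' S' := by
  cases hs with
  | pop _ _ x k hpc hx hmax => exact ⟨S, h.pop hpc hx hmax⟩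
  | blacklist _ _ x hpc hT => exact ⟨S, h.blacklist hpc⟩
  | accept _ _ x hpc hT =>
    have hp := h.pc
    rw [hpc] at hp
    exact ⟨S, h.disjoint, h.queue_visited, h.prio_le, h.le_prio, h.alpha, h.bound, h.q_le, hp⟩
  | claim _ _ x hpc =>
    have hp := h.pc
    rw [hpc] at hp
    exact ⟨S, h.disjoint, h.queue_visited, h.prio_le, h.le_prio, h.alpha, h.bound, h.q_le, hp⟩
  | update _ _ x hpc => exact ⟨_, h.update hpc⟩
  | scanMark _ _ x y todo hpc hy hyb hyv hmark => exact ⟨S, h.scanEdge hpc hy hyb hyv⟩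
  | scanPlain _ _ x y todo hpc hy hyb hyv hmark => exact ⟨S, h.scanEdge hpc hy hyb hyv⟩
  | skip _ _ x y todo hpc hy hyn => exact ⟨S, h.skip hpc hyn⟩
  | done _ _ x hpc =>
    have hp := h.pc
    rw [hpc] at hp
    obtain ⟨hxS, -, hvis, hr, ht⟩ := hp
    exact ⟨S, h.disjoint, h.queue_visited, h.prio_le, h.le_prio, h.alpha, h.bound, h.q_le,
      hvis, fun y hy => by simpa using hr y hy, Or.inr ⟨x, ht⟩⟩

theorem ProcStep.bound_le {G : WGraph V} {capped : Bool} {l l' : Local V} {sh sh' : Shared V}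
    {e : Event V} (hs : ProcStep G capped e l sh l' sh') : l'.bound ≤ l.bound := by
  cases hs with
  | update _ _ x hpc => dsimp only; split_ifs <;> simp
  | _ => exact le_rfl

theorem Step.bound_le {G : WGraph V} {capped : Bool} {p : ℕ} {i : Fin p} {e : Event V}
    {s s' : State V p} (hs : Step G capped i e s s') (j : Fin p) :
    (s'.proc j).bound ≤ (s.proc j).bound := by
  cases hs with
  | run _ i e l' sh' h =>
    by_cases hj : j = i
    · subst hj; simpa using h.bound_le
    · simp [Function.update_of_ne hj]
  | sync _ i k =>
    by_cases hj : j = i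
    · subst hj; simp
    · simp [Function.update_of_ne hj]

theorem Reachable.localInv {G : WGraph V} {capped : Bool} {p : ℕ} {start : Fin p → V}
    {bound₀ : ℕ} {s : State V p} (hs : Reachable G capped start bound₀ s) (i : Fin p) :
    ∃ S, LocalInv G capped bound₀ (s.proc i) S := by
  induction hs generalizing i with
  | init => exact ⟨∅, LocalInv.init G capped (start i) bound₀⟩
  | @step s s' j e _ hstep ih =>
    cases hstep with
    | run _ _ _ l' sh' h =>
      by_cases hj : i = j
      · subst hj
        obtain ⟨S, hS⟩ := ih i
        simpa using hS.step h
      · simpa [Function.update_of_ne hj] using ih i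
    | sync _ _ k =>
      by_cases hj : i = j
      · subst hj
        obtain ⟨S, hS⟩ := ih i
        obtain ⟨S', hS'⟩ := ih k
        refine ⟨S, ?_⟩
        simp only [Function.update_self]
        refine hS.lower (min_le_left _ _) ?_
        rcases min_choice (Local.bound _) (Local.bound _) with hm | hm <;> rw [hm]
        exacts [hS.bound, hS'.bound]
      · simpa [Function.update_of_ne hj] using ih i

/-- The connectivity of a scanned edge. -/
theorem Reachable.scan {G : WGraph V} {capped : Bool} {p : ℕ} {start : Fin p → V}
    {bound₀ : ℕ} {s s' : State V p} (hs : Reachable G capped start bound₀ s) {i : Fin p}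
    {x y : V} {marked : Bool} (hstep : Step G capped i (Event.scan x y marked) s s') :
    G.graph.Adj x y ∧
      (marked = true → (s.proc i).bound ≤ (s'.proc i).q s(x, y)) ∧
      ∃ (hx : x ∉ (s.proc i).blacklist) (hy : y ∉ (s.proc i).blacklist),
        ∀ L, Reliable capped (s.proc i).bound L → min ((s'.proc i).q s(x, y)) L ≤
          (G.remove (s.proc i).blacklist).conn ⟨x, hx⟩ ⟨y, hy⟩ := by
  obtain ⟨S, hS⟩ := hs.localInv i
  cases hstep with
  | run _ i e l' sh' h =>
    cases h with
    | scanMark _ _ x y todo hpc hy hyb hyv hmark =>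
      obtain ⟨hadj, hx, hle⟩ := hS.scan hpc hy hyb hyv
      exact ⟨hadj, by simpa [Local.scanEdge] using hmark.2, hx, hyb,
        by simpa [Local.scanEdge] using hle⟩
    | scanPlain _ _ x y todo hpc hy hyb hyv hmark =>
      obtain ⟨hadj, hx, hle⟩ := hS.scan hpc hy hyb hyv
      exact ⟨hadj, by simp, hx, hyb, by simpa [Local.scanEdge] using hle⟩

theorem Reachable.bound_le_conn {G : WGraph V} {capped : Bool} {p : ℕ} {start : Fin p → V}
    {bound₀ : ℕ} {s s' : State V p} (hs : Reachable G capped start bound₀ s) {i : Fin p}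
    {x y : V} (hstep : Step G capped i (Event.scan x y true) s s') :
    (s.proc i).bound ≤ G.conn x y := by
  obtain ⟨hadj, hm, hx, hy, hle⟩ := hs.scan hstep
  have h := (hle _ (Or.inr le_rfl)).trans (G.conn_remove_le hx hy hadj.ne)
  rwa [min_eq_right (hm rfl)] at h

theorem Step.union_eq_or {G : WGraph V} {capped : Bool} {p : ℕ} {i : Fin p} {e : Event V}
    {s s' : State V p} (hs : Step G capped i e s s') :
    s'.shared.U = s.shared.U ∨
      ∃ x y, e = Event.scan x y true ∧ s'.shared.U = unite s.shared.U x y := by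
  cases hs with
  | run _ i e l' sh' h =>
    cases h with
    | scanMark _ _ x y todo hpc hy hyb hyv hmark => exact Or.inr ⟨x, y, rfl, rfl⟩
    | _ => exact Or.inl rfl
  | sync _ i k => exact Or.inl rfl

theorem Reachable.union_le {G : WGraph V} {capped : Bool} {p : ℕ} {start : Fin p → V}
    {bound₀ : ℕ} {s : State V p} (hs : Reachable G capped start bound₀ s) {A : Finset V}
    (hA : ∀ i, G.cap A < (s.proc i).bound) : s.shared.U ≤ Setoid.ker (· ∈ A) := by
  induction hs with
  | init => exact bot_le
  | @step s s' i e hs hstep ih =>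
    have hA' : ∀ j, G.cap A < (s.proc j).bound := fun j => (hA j).trans_le (hstep.bound_le j)
    rcases hstep.union_eq_or with h | ⟨x, y, rfl, h⟩
    · rw [h]; exact ih hA'
    · rw [h]
      refine unite_le (ih hA') (propext ?_)
      have hc := (hA' i).trans_le (hs.bound_le_conn hstep)
      have hxy : x ≠ y := (hs.scan hstep).1.ne
      refine ⟨fun hx => ?_, fun hy => ?_⟩ <;> by_contra hn
      · exact absurd (G.conn_le_cap hx hn) hc.not_ge
      · rw [G.conn_comm hxy] at hc
        exact absurd (G.conn_le_cap hy hn) hc.not_ge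

end Invariant

end ParCut

theorem mainTheorem2 {V : Type*} [Fintype V] [DecidableEq V] (G : ParCut.WGraph V)
    (capped : Bool) (p : ℕ) (start : Fin p → V) (bound₀ : ℕ) (s : ParCut.State V p)
    (hs : ParCut.Reachable G capped start bound₀ s) :
    -- a marked edge has connectivity at least the bound in use when it is marked
    (∀ (i : Fin p) (x y : V) (s' : ParCut.State V p),
      ParCut.Step G capped i (ParCut.Event.scan x y true) s s' →
        G.graph.Adj x y ∧ (s.proc i).bound ≤ G.conn x y) ∧
    -- no cut of capacity below the bounds is contracted
    (∀ A : Finset V, (∀ i, G.cap A < (s.proc i).bound) → ¬ ParCut.Contracts s.shared.U A) ∧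
    -- every bound is the initial one, or is below it and is the capacity of a cut
    (∀ i : Fin p, (s.proc i).bound = bound₀ ∨
      (s.proc i).bound < bound₀ ∧
        ∃ A : Finset V, A ≠ ∅ ∧ A ≠ Finset.univ ∧ (s.proc i).bound = G.cap A) ∧
    -- the value `q(e)` assigned when `e` is scanned, in the graph without the vertices that are
    -- blacklisted at that time
    (∀ (i : Fin p) (x y : V) (marked : Bool) (s' : ParCut.State V p),
      ParCut.Step G capped i (ParCut.Event.scan x y marked) s s' →
        ∃ (hx : x ∉ (s.proc i).blacklist) (hy : y ∉ (s.proc i).blacklist),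
          (capped = false →
            (s'.proc i).q s(x, y) ≤
              (G.remove (s.proc i).blacklist).conn ⟨x, hx⟩ ⟨y, hy⟩) ∧
          min ((s'.proc i).q s(x, y)) (s.proc i).bound ≤
            (G.remove (s.proc i).blacklist).conn ⟨x, hx⟩ ⟨y, hy⟩ ∧
          (G.remove (s.proc i).blacklist).conn ⟨x, hx⟩ ⟨y, hy⟩ ≤ G.conn x y) ∧
    -- the values `q(e)` at any time, in the whole graph
    (∀ (i : Fin p) (x y : V), G.graph.Adj x y →
      (capped = false → (s.proc i).q s(x, y) ≤ G.conn x y) ∧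
      ((s.proc i).bound ≤ (s.proc i).q s(x, y) → (s.proc i).bound ≤ G.conn x y)) := by

  refine ⟨fun i x y s' hstep => ⟨(hs.scan hstep).1, hs.bound_le_conn hstep⟩, ?_, ?_, ?_, ?_⟩
  · rintro A hA ⟨u, v, huv, hu, hv⟩
    have h : (u ∈ A) = (v ∈ A) := hs.union_le hA huv
    exact hv (h ▸ hu)
  · intro i
    obtain ⟨S, hS⟩ := hs.localInv i
    exact hS.bound
  · intro i x y marked s' hstep
    obtain ⟨hadj, -, hx, hy, hle⟩ := hs.scan hstep
    exact ⟨hx, hy, fun hc => by simpa using hle ((s'.proc i).q s(x, y)) (Or.inl hc),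
      hle _ (Or.inr le_rfl), G.conn_remove_le hx hy hadj.ne⟩
  · intro i x y hadj
    obtain ⟨S, hS⟩ := hs.localInv i
    refine ⟨fun hc => by simpa using hS.q_le ((s.proc i).q s(x, y)) (Or.inl hc) x y hadj,
      fun hq => ?_⟩
    simpa [min_eq_right hq] using hS.q_le _ (Or.inr le_rfl) x y hadj
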